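/- Let $M=(m_{i,j})_{i,j=1}^d$ be a vine structure matrix, i.e. a lower-triangular matrix with labels in $\{1,\dots,d\}$ on and below the diagonal such that (1) $\{m_{j,j},\dots,m_{d,j}\}\subseteq\{m_{i,i},\dots,m_{d,i}\}$ for $i<j$; (2) $m_{i,i}\notin\{m_{i+1,i+1},\dots,m_{d,i+1}\}$ for $i<d$; (3) for all $1\le i\le d-2$ and $i<k\le d$ there is $j$ with $i<j\le k$ such that either $m_{k,i}=m_{j,j}$ and $\{m_{k+1,i},\dots,m_{d,i}\}=\{m_{k+1,j},\dots,m_{d,j}\}$, or $k<d$, $m_{k,i}=m_{k+1,j}$ and $\{m_{k+1,i},\dots,m_{d,i}\}=\{m_{j,j},m_{k+2,j},\dots,m_{d,j}\}$. Assume moreover that the diagonal of $M$ is $1,2,\dots,d$. Let $\mathbf U=(U_1,\dots,U_d)$ be a random vector whose distribution is a copula (uniform margins on $[0,1]$) with a density $c$ with respect to Lebesgue measure on $[0,1]^d$. For a set $D$ of indices write $C_{a|D}(\cdot\,|\,u_D)$ for the distribution function of the conditional distribution of $U_a$ given $U_D=u_D$. For all $1\le j<k\le d$, with $D_{k,j}=\{m_{k+1,j},\dots,m_{d,j}\}$,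 let $c_{m_{k,j},m_{j,j};D_{k,j}}(\cdot,\cdot\,;u_{D_{k,j}})$ be the copula density of the conditional distribution of $(U_{m_{k,j}},U_{m_{j,j}})$ given $U_{D_{k,j}}=u_{D_{k,j}}$ (the density of the copula which links the conditional joint distribution function to its two conditional margins in Sklar's theorem), jointly measurable in all its arguments; these are the pair-copula densities of the vine with structure matrix $M$. Then for every $j<d$ the conditional distribution of $U_j$ given $(U_{j+1},\dots,U_d)=(u_{j+1},\dots,u_d)$ has, for almost every $(u_{j+1},\dots,u_d)$ with respect to the distribution of $(U_{j+1},\dots,U_d)$, the density on $[0,1]$ $$c_{j|(j+1):d}(u_j\,|\,u_{j+1},\dots,u_d)=\prod_{k=j+1}^{d} c_{m_{k,j},m_{j,j};D_{k,j}}\Big(C_{m_{k,j}|D_{k,j}}\big(u_{m_{k,j}}\,|\,u_{D_{k,j}}\big),\;C_{m_{j,j}|D_{k,j}}\big(u_{m_{j,j}}\,|\,u_{D_{k,j}}\big);\;u_{D_{k,j}}\Big).$$ -/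

import Mathlib

open MeasureTheory ProbabilityTheory

noncomputable section

/-- The entries `m_{k+1,j}, …, m_{d,j}` strictly below row `k` in column `j`. -/
def vineBelow {d : ℕ} (M : Matrix (Fin d) (Fin d) (Fin d)) (k j : Fin d) : Finset (Fin d) :=
  (Finset.Ioi k).image (fun l => M l j)

/-- The entries `m_{j,j}, …, m_{d,j}` of column `j` on and below the diagonal. -/
def vineColumn {d : ℕ} (M : Matrix (Fin d) (Fin d) (Fin d)) (j : Fin d) : Finset (Fin d) :=
  (Finset.Ici j).image (fun l => M l j)

/-- Vine structure matrices.  Rows, columns and variable labels are all indexed by `Fin d`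
(counting from `0`).  Only the lower triangle `j ≤ i` carries information; the positions above
the diagonal, which are left blank (filled with a non-label) in the literature, are never read.
The bound `j ≤ k` in the third property says that only entries strictly below the diagonal of
column `j` occur as `m_{k+1,j}, …, m_{d,j}`. -/
structure IsVineStructureMatrix {d : ℕ} (M : Matrix (Fin d) (Fin d) (Fin d)) : Prop where
  column_subset : ∀ i j : Fin d, i < j → vineColumn M j ⊆ vineColumn M i
  diag_notMem : ∀ i i' : Fin d, (i' : ℕ) = i + 1 → M i i ∉ vineColumn M i'
  proximity : ∀ i k : Fin d, (i : ℕ) + 2 < d → i < k → ∃ j : Fin d, i < j ∧ j ≤ k ∧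
    ((M k i = M j j ∧ vineBelow M k i = vineBelow M k j) ∨
      ∃ k' : Fin d, (k' : ℕ) = k + 1 ∧ M k i = M k' j ∧
        vineBelow M k i = insert (M j j) (vineBelow M k' j))

/-- The measure on `[0,1]ⁿ` with Lebesgue density `c`. -/
def copulaMeasure {n : ℕ} (c : (Fin n → ℝ) → ℝ) : Measure (Fin n → ℝ) :=
  (volume.restrict (Set.Icc 0 1)).withDensity (fun u => ENNReal.ofReal (c u))

/-- `c` is (a version of) the density of an `n`-dimensional copula: a density on `[0,1]ⁿ`
all of whose one-dimensional margins are uniform on `[0,1]`. -/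
structure IsCopulaDensity {n : ℕ} (c : (Fin n → ℝ) → ℝ) : Prop where
  measurable : Measurable c
  nonneg : ∀ u ∈ Set.Icc (0 : Fin n → ℝ) 1, 0 ≤ c u
  uniform_margin : ∀ i : Fin n,
    (copulaMeasure c).map (fun u => u i) = volume.restrict (Set.Icc (0 : ℝ) 1)

variable {Ω : Type*} [MeasurableSpace Ω] {d : ℕ}

/-- `condDF P U a D v x` is `C_{a|D}(x | v) = P(U_a ≤ x | U_D = v)`, the distribution function of
the conditional distribution of `U_a` given `U_D = v`. -/
def condDF (P : Measure Ω) [IsFiniteMeasure P] (U : Ω → Fin d → ℝ) (a : Fin d)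
    (D : Finset (Fin d)) (v : D → ℝ) (x : ℝ) : ℝ :=
  (condDistrib (fun ω => U ω a) (fun ω => D.restrict (U ω)) P v).real (Set.Iic x)

/-- `q v` is, for almost every value `v` of `U_D`, the copula density `c_{a,b;D}(·,·; v)` of the
conditional distribution of `(U_a, U_b)` given `U_D = v`: the copula with density `q v` links the
conditional joint distribution function to its two conditional margins as in Sklar's theorem. -/
structure IsCondPairCopulaDensity (P : Measure Ω) [IsFiniteMeasure P] (U : Ω → Fin d → ℝ)
    (a b : Fin d) (D : Finset (Fin d)) (q : (D → ℝ) → (Fin 2 → ℝ) → ℝ) : Prop where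
  measurable : Measurable (Function.uncurry q)
  isCopulaDensity : ∀ᵐ v ∂(P.map (fun ω => D.restrict (U ω))), IsCopulaDensity (q v)
  sklar : ∀ᵐ v ∂(P.map (fun ω => D.restrict (U ω))), ∀ x y : ℝ,
    (condDistrib (fun ω => (U ω a, U ω b)) (fun ω => D.restrict (U ω)) P v).real
        (Set.Iic x ×ˢ Set.Iic y) =
      (copulaMeasure (q v)).real (Set.Iic ![condDF P U a D v x, condDF P U b D v y])

/-- A candidate family of pair-copula densities `c_{a,b;D}(s, t; v)`, written
`pc a b D v ![s, t]`. -/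
abbrev PairCopulaFamily (d : ℕ) : Type :=
  (a b : Fin d) → (D : Finset (Fin d)) → (D → ℝ) → (Fin 2 → ℝ) → ℝ

/-- `U` is a random vector whose distribution is the copula with density `c`, decomposed along the
vine with structure matrix `M` into the pair-copula densities `pc`: for every entry below the
diagonal, at position `(k, j)`, the member of `pc` with conditioned variables `m_{k,j}`, `m_{j,j}`
and conditioning variables `m_{k+1,j}, …, m_{d,j}` is the corresponding conditional pair-copula
density of `U`. -/
structure HasVineCopulaDensity (P : Measure Ω) [IsFiniteMeasure P] (U : Ω → Fin d → ℝ)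
    (M : Matrix (Fin d) (Fin d) (Fin d)) (pc : PairCopulaFamily d)
    (c : (Fin d → ℝ) → ℝ) : Prop where
  measurable : Measurable U
  isCopulaDensity : IsCopulaDensity c
  law : P.map U = copulaMeasure c
  isVineStructureMatrix : IsVineStructureMatrix M
  pairCopula : ∀ j k : Fin d, j < k →
    IsCondPairCopulaDensity P U (M k j) (M j j) (vineBelow M k j)
      (pc (M k j) (M j j) (vineBelow M k j))

/-- The pair-copula term of the entry `m_{k,j}` at the point `u`: the pair-copula density
evaluated at the conditional distribution functions of its two conditioned variables. -/
def pairCopulaTerm (P : Measure Ω) [IsFiniteMeasure P] (U : Ω → Fin d → ℝ)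
    (M : Matrix (Fin d) (Fin d) (Fin d)) (pc : PairCopulaFamily d) (k j : Fin d)
    (u : Fin d → ℝ) : ℝ :=
  pc (M k j) (M j j) (vineBelow M k j) ((vineBelow M k j).restrict u)
    ![condDF P U (M k j) (vineBelow M k j) ((vineBelow M k j).restrict u) (u (M k j)),
      condDF P U (M j j) (vineBelow M k j) ((vineBelow M k j).restrict u) (u (M j j))]

/-- The real function `f` on `ℝᵈ` is, as a function of `u_j` and of `u_D`, a density on `[0,1]` of
the conditional distribution of `U_j` given `U_D = u_D`, for almost every value of `U_D` and
whatever the values of the remaining coordinates. -/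
def IsCondDensity (P : Measure Ω) [IsFiniteMeasure P] (U : Ω → Fin d → ℝ) (j : Fin d)
    (D : Finset (Fin d)) (f : (Fin d → ℝ) → ℝ) : Prop :=
  ∀ᵐ v ∂(P.map (fun ω => D.restrict (U ω))), ∀ u : Fin d → ℝ, D.restrict u = v →
    condDistrib (fun ω => U ω j) (fun ω => D.restrict (U ω)) P v =
      (volume.restrict (Set.Icc (0 : ℝ) 1)).withDensity
        (fun x => ENNReal.ofReal (f (Function.update u j x)))

end

/-!
Since the columns of `M` are nested and the diagonal is the identity, column `j` contains every
label `≥ j` (`vineColumn_eq_Ici`), and by counting each occurs exactly once. Hence the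
conditioning sets `D_k = {m_{k+1,j}, …}` grow by one new label `m_{k,j}` at a time, from `∅` in the
last row to all the labels `> j` in row `j`, and none of them contains `j`. It suffices to follow
the conditional distribution of `U_j` given `U_{D_k}` as `k` decreases
(`HasVineCopulaDensity.isCondDensity_vineBelow`): for `D = ∅` it is uniform, and each new label
contributes one pair-copula factor.

The step (`IsCondDensity.insert`) passes from `D` to `D ∪ {a}`. Since `U` has a Lebesgue density,
the conditional distributions `μ_v` of `U_a` and `ν_v` of `U_b` given `U_D = v` have no atoms for
almost every `v`. For atomless `μ`, `ν` with distribution functions `F`, `G`, the map `(F, G)` pushes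
`μ × ν` to the uniform distribution on the square, and `{F ≤ F(x)}` is `(-∞, x]` up to a null set;
so Sklar's identity says precisely that the joint conditional distribution is
`q_v(F, G) · (μ_v × ν_v)` (`eq_withDensity_of_sklar`), without differentiating any distribution
function. Disintegrating with respect to the first coordinate, the conditional distribution of `U_b`
given `U_D = v` and `U_a = x` is `q_v(F(x), G) · ν_v` (`condDistrib_adjoin_eq_withDensity`): the old
density is multiplied by the pair-copula term.
-/

open Set Filter Topology

/-! ### Distribution functions of atomless measures -/

lemma continuous_real_Iic (μ : Measure ℝ) [IsProbabilityMeasure μ] [NullSingletonClass μ] :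
    Continuous (fun x => μ.real (Iic x)) := by
  have h1 : (fun x => μ.real (Iic x)) = cdf μ := by
    ext x; rw [cdf_eq_real]
  rw [h1, continuous_iff_continuousAt]
  intro x
  rw [(cdf μ).mono.continuousAt_iff_leftLim_eq_rightLim, StieltjesFunction.rightLim_eq]
  refine le_antisymm ((cdf μ).mono.leftLim_le le_rfl) ?_
  have h2 : (cdf μ).measure {x} = 0 := by rw [measure_cdf]; simp
  rw [StieltjesFunction.measure_singleton, ENNReal.ofReal_eq_zero] at h2
  linarith

/-- The sublevel set at a level `0 ≤ t < 1` is empty or a closed half-line `(-∞, s]`, where `s` is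
the largest point with distribution function `t`. -/
lemma measure_setOf_real_Iic_le (μ : Measure ℝ) [IsProbabilityMeasure μ] [NullSingletonClass μ]
    (t : ℝ) :
    μ {x | μ.real (Iic x) ≤ t} = volume (Iic t ∩ Icc (0 : ℝ) 1) := by
  have hF := continuous_real_Iic μ
  have hmono : Monotone fun x => μ.real (Iic x) :=
    fun x y hxy => measureReal_mono (Iic_subset_Iic.2 hxy)
  have hbot : Tendsto (fun x => μ.real (Iic x)) atBot (𝓝 0) := by
    simpa only [← cdf_eq_real] using tendsto_cdf_atBot μ
  have htop : Tendsto (fun x => μ.real (Iic x)) atTop (𝓝 1) := by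
    simpa only [← cdf_eq_real] using tendsto_cdf_atTop μ
  rcases lt_or_ge t 0 with ht0 | ht0
  · have h1 : {x | μ.real (Iic x) ≤ t} = ∅ := by
      ext x
      simpa using ht0.trans_le measureReal_nonneg
    have h2 : Iic t ∩ Icc (0 : ℝ) 1 = ∅ := by
      ext x
      simp only [mem_inter_iff, mem_Iic, mem_Icc, mem_empty_iff_false, iff_false]
      intro h
      linarith [h.1, h.2.1]
    simp [h1, h2]
  rcases le_or_gt 1 t with ht1 | ht1
  · have h1 : {x | μ.real (Iic x) ≤ t} = univ := by
      ext x
      simpa using measureReal_le_one.trans ht1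
    have h2 : Iic t ∩ Icc (0 : ℝ) 1 = Icc 0 1 :=
      inter_eq_right.2 fun x hx => hx.2.trans ht1
    simp [h1, h2]
  have h2 : Iic t ∩ Icc (0 : ℝ) 1 = Icc 0 t := by
    ext x
    simp only [mem_inter_iff, mem_Iic, mem_Icc]
    constructor
    · rintro ⟨h, h', -⟩; exact ⟨h', h⟩
    · rintro ⟨h, h'⟩; exact ⟨h', h, h'.trans ht1.le⟩
  rw [h2, Real.volume_Icc, sub_zero]
  set S : Set ℝ := {x | μ.real (Iic x) ≤ t} with hS
  rcases S.eq_empty_or_nonempty with hE | hne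
  · have h3 : t ≤ 0 := by
      refine ge_of_tendsto hbot (Eventually.of_forall fun x => ?_)
      have hx : x ∉ S := by simp [hE]
      exact (not_le.1 hx).le
    simp [hE, ENNReal.ofReal_of_nonpos h3]
  have hclosed : IsClosed S := isClosed_le hF continuous_const
  have hbdd : BddAbove S := by
    obtain ⟨b, hb⟩ := (htop.eventually (lt_mem_nhds ht1)).exists
    exact ⟨b, fun x hx => le_of_not_gt fun hbx => absurd (hmono hbx.le)
      (not_le.2 (lt_of_le_of_lt hx hb))⟩
  have hmem : sSup S ∈ S := hclosed.csSup_mem hne hbdd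
  have hSeq : S = Iic (sSup S) :=
    Subset.antisymm (fun x hx => le_csSup hbdd hx) fun x hx => (hmono hx).trans hmem
  have hge : t ≤ μ.real (Iic (sSup S)) := by
    refine ge_of_tendsto (hF.continuousAt.tendsto.mono_left
      (nhdsWithin_le_nhds (s := Ioi (sSup S)))) ?_
    filter_upwards [self_mem_nhdsWithin] with y hy
    exact (not_le.1 fun hyS => absurd (le_csSup hbdd (show y ∈ S from hyS)) (not_le.2 hy)).le
  rw [hSeq, ← le_antisymm hmem hge, ofReal_measureReal]

/-- The probability integral transform. -/
lemma map_real_Iic (μ : Measure ℝ) [IsProbabilityMeasure μ] [NullSingletonClass μ] :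
    μ.map (fun x => μ.real (Iic x)) = volume.restrict (Icc (0 : ℝ) 1) := by
  have hF := (continuous_real_Iic μ).measurable
  refine Measure.ext_of_Iic _ _ fun t => ?_
  rw [Measure.map_apply hF measurableSet_Iic, Measure.restrict_apply measurableSet_Iic]
  exact measure_setOf_real_Iic_le μ t

/-- The distribution function may be constant on an interval to the right of `x`, but only on one
that carries no mass. -/
lemma Iic_ae_eq_setOf_real_Iic_le (μ : Measure ℝ) [IsProbabilityMeasure μ] [NullSingletonClass μ]
    (x : ℝ) :
    (Iic x : Set ℝ) =ᵐ[μ] {y | μ.real (Iic y) ≤ μ.real (Iic x)} := by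
  refine ae_eq_of_subset_of_measure_ge
    (fun y hy => measureReal_mono (Iic_subset_Iic.2 hy)) ?_ measurableSet_Iic.nullMeasurableSet
    (measure_ne_top _ _)
  rw [measure_setOf_real_Iic_le]
  calc volume (Iic (μ.real (Iic x)) ∩ Icc (0 : ℝ) 1)
      ≤ volume (Icc (0 : ℝ) (μ.real (Iic x))) := measure_mono fun y hy => ⟨hy.2.1, hy.1⟩
    _ = μ (Iic x) := by rw [Real.volume_Icc, sub_zero, ofReal_measureReal]

/-! ### Sklar's identity as a density -/

/-- Quadrants determine a finite measure on the plane; the one-dimensional `Measure.ext_of_Iic` is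
applied in each coordinate in turn. -/
lemma MeasureTheory.Measure.ext_of_Iic_prod (ρ σ : Measure (ℝ × ℝ)) [IsFiniteMeasure ρ]
    [IsFiniteMeasure σ] (h : ∀ x y, ρ (Iic x ×ˢ Iic y) = σ (Iic x ×ˢ Iic y)) : ρ = σ := by
  have key1 : ∀ (τ : Measure (ℝ × ℝ)) (s t : Set ℝ), MeasurableSet s → MeasurableSet t →
      ((τ.restrict (univ ×ˢ t)).map Prod.fst) s = τ (s ×ˢ t) := fun τ s t hs ht => by
    rw [Measure.map_apply measurable_fst hs, Measure.restrict_apply (measurable_fst hs)]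
    congr 1; ext; simp
  have key2 : ∀ (τ : Measure (ℝ × ℝ)) (s t : Set ℝ), MeasurableSet s → MeasurableSet t →
      ((τ.restrict (s ×ˢ univ)).map Prod.snd) t = τ (s ×ˢ t) := fun τ s t hs ht => by
    rw [Measure.map_apply measurable_snd ht, Measure.restrict_apply (measurable_snd ht)]
    congr 1; ext; simp [and_comm]
  have step : ∀ s y, MeasurableSet s → ρ (s ×ˢ Iic y) = σ (s ×ˢ Iic y) := fun s y hs => by
    rw [← key1 _ _ _ hs measurableSet_Iic, ← key1 _ _ _ hs measurableSet_Iic]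
    congr 1
    refine Measure.ext_of_Iic _ _ fun x => ?_
    rw [key1 _ _ _ measurableSet_Iic measurableSet_Iic,
      key1 _ _ _ measurableSet_Iic measurableSet_Iic, h]
  refine Measure.ext_prod fun {s t} hs ht => ?_
  rw [← key2 _ _ _ hs ht, ← key2 _ _ _ hs ht]
  congr 1
  refine Measure.ext_of_Iic _ _ fun y => ?_
  rw [key2 _ _ _ hs measurableSet_Iic, key2 _ _ _ hs measurableSet_Iic, step s y hs]

lemma restrict_Icc_pi (ι : Type*) [Fintype ι] :
    (volume : Measure (ι → ℝ)).restrict (Icc 0 1) =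
      Measure.pi fun _ => (volume : Measure ℝ).restrict (Icc (0 : ℝ) 1) := by
  rw [← pi_univ_Icc, volume_pi, Measure.restrict_pi_pi]
  rfl

lemma IsCopulaDensity.copulaMeasure_univ {n : ℕ} {c : (Fin n → ℝ) → ℝ} (hc : IsCopulaDensity c)
    (i : Fin n) : copulaMeasure c univ = 1 := by
  have h := congrArg (fun m => m univ) (hc.uniform_margin i)
  simpa [Measure.map_apply (measurable_pi_apply i) MeasurableSet.univ] using h

lemma map_prod_real_Iic (μ ν : Measure ℝ) [IsProbabilityMeasure μ] [NullSingletonClass μ]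
    [IsProbabilityMeasure ν] [NullSingletonClass ν] :
    (μ.prod ν).map (fun p => ![μ.real (Iic p.1), ν.real (Iic p.2)]) =
      (volume : Measure (Fin 2 → ℝ)).restrict (Icc 0 1) := by
  have hF := (continuous_real_Iic μ).measurable
  have hG := (continuous_real_Iic ν).measurable
  have h1 := ((measurePreserving_finTwoArrow
    ((volume : Measure ℝ).restrict (Icc (0 : ℝ) 1))).symm).map_eq
  have h2 : ((volume : Measure ℝ).restrict (Icc (0 : ℝ) 1)).prod
      ((volume : Measure ℝ).restrict (Icc (0 : ℝ) 1)) =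
      (μ.prod ν).map (Prod.map (fun x => μ.real (Iic x)) fun y => ν.real (Iic y)) := by
    rw [← Measure.map_prod_map _ _ hF hG, map_real_Iic, map_real_Iic]
  rw [restrict_Icc_pi, ← h1, h2,
    Measure.map_map (MeasurableEquiv.measurable _) (hF.prodMap hG)]
  congr 1

/-- If a copula with density `q` links `ρ` to the atomless distributions `μ` and `ν`, then `ρ` has
density `q (F, G)` with respect to `μ.prod ν`, where `F` and `G` are the distribution functions.
That `μ` and `ν` are the margins of `ρ` is a consequence of `h`, not a hypothesis. -/
lemma eq_withDensity_of_sklar (ρ : Measure (ℝ × ℝ)) [IsProbabilityMeasure ρ] (μ ν : Measure ℝ)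
    [IsProbabilityMeasure μ] [NullSingletonClass μ] [IsProbabilityMeasure ν] [NullSingletonClass ν]
    {q : (Fin 2 → ℝ) → ℝ} (hq : IsCopulaDensity q)
    (h : ∀ x y, ρ.real (Iic x ×ˢ Iic y) =
      (copulaMeasure q).real (Iic ![μ.real (Iic x), ν.real (Iic y)])) :
    ρ = (μ.prod ν).withDensity
      fun p => ENNReal.ofReal (q ![μ.real (Iic p.1), ν.real (Iic p.2)]) := by
  have hF := (continuous_real_Iic μ).measurable
  have hG := (continuous_real_Iic ν).measurable
  set Φ : ℝ × ℝ → Fin 2 → ℝ := fun p => ![μ.real (Iic p.1), ν.real (Iic p.2)] with hΦ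
  have hΦm : Measurable Φ := by
    refine measurable_pi_iff.2 fun i => ?_
    fin_cases i
    · exact hF.comp measurable_fst
    · exact hG.comp measurable_snd
  have hqm : Measurable fun u => ENNReal.ofReal (q u) := hq.measurable.ennreal_ofReal
  have hmap : ∀ s, MeasurableSet s →
      ((μ.prod ν).withDensity fun p => ENNReal.ofReal (q (Φ p))) (Φ ⁻¹' s) =
        copulaMeasure q s := fun s hs => by
    rw [withDensity_apply _ (hΦm hs), copulaMeasure, withDensity_apply _ hs,
      ← map_prod_real_Iic μ ν, setLIntegral_map hs hqm hΦm]
  have : IsFiniteMeasure (copulaMeasure q) := ⟨by simp [hq.copulaMeasure_univ 0]⟩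
  have : IsFiniteMeasure ((μ.prod ν).withDensity fun p => ENNReal.ofReal (q (Φ p))) :=
    ⟨by rw [← preimage_univ (f := Φ), hmap _ MeasurableSet.univ]; exact measure_lt_top _ _⟩
  refine Measure.ext_of_Iic_prod _ _ fun x y => ?_
  have hae : (Iic x ×ˢ Iic y : Set (ℝ × ℝ)) =ᵐ[μ.prod ν] Φ ⁻¹' Iic (Φ (x, y)) := by
    have h2 : Φ ⁻¹' Iic (Φ (x, y)) = {x' | μ.real (Iic x') ≤ μ.real (Iic x)} ×ˢ
        {y' | ν.real (Iic y') ≤ ν.real (Iic y)} := by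
      ext p
      simp [hΦ, Pi.le_def, Fin.forall_fin_two]
    rw [h2]
    exact Measure.set_prod_ae_eq (Iic_ae_eq_setOf_real_Iic_le μ x)
      (Iic_ae_eq_setOf_real_Iic_le ν y)
  rw [measure_congr ((withDensity_absolutelyContinuous _ _).ae_eq hae),
    hmap _ measurableSet_Iic, ← ofReal_measureReal, ← ofReal_measureReal (μ := copulaMeasure q)]
  exact congrArg _ (h x y)

/-! ### Disintegration of a joint density -/

/-- Uniqueness of the conditional distribution among s-finite kernels: the disintegration forces
`η` to be Markov almost everywhere. This removes the finiteness hypothesis of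
`condDistrib_ae_eq_of_measure_eq_compProd`, which fails on a null set for kernels
given by densities. -/
lemma condDistrib_ae_eq_of_measure_eq_compProd_of_isSFiniteKernel {Ω β : Type*}
    [MeasurableSpace Ω] [MeasurableSpace β] {P : Measure Ω} [IsFiniteMeasure P] {X : Ω → β}
    {Y : Ω → ℝ} (hX : Measurable X) (hY : Measurable Y) (η : Kernel β ℝ) [IsSFiniteKernel η]
    (h : P.map (fun ω => (X ω, Y ω)) = P.map X ⊗ₘ η) :
    condDistrib Y X P =ᵐ[P.map X] η := by
  have hone : ∀ᵐ b ∂P.map X, η b univ = 1 := by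
    refine ae_eq_of_forall_setLIntegral_eq_of_sigmaFinite (η.measurable_coe MeasurableSet.univ)
      measurable_const fun s hs _ => ?_
    rw [← Measure.compProd_apply_prod hs MeasurableSet.univ, ← h,
      Measure.map_apply (hX.prodMk hY) (hs.prod MeasurableSet.univ), setLIntegral_one,
      Measure.map_apply hX hs]
    congr 1; ext; simp
  have hs : MeasurableSet {b | η b univ = 1} :=
    (η.measurable_coe MeasurableSet.univ) (measurableSet_singleton 1)
  classical
  -- Truncating `η` to the points where it has mass one gives a finite kernel.
  set η' : Kernel β ℝ := Kernel.piecewise hs η 0 with hη'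
  have hηη' : η =ᵐ[P.map X] η' := by
    filter_upwards [hone] with b hb
    rw [hη', Kernel.piecewise_apply]
    exact (if_pos (show b ∈ {b | η b univ = 1} from hb)).symm
  have : IsFiniteKernel η' := by
    refine ⟨1, ENNReal.one_lt_top, fun b => ?_⟩
    rw [hη', Kernel.piecewise_apply]
    split_ifs with hb
    · exact le_of_eq hb
    · simp
  refine (condDistrib_ae_eq_of_measure_eq_compProd X hY.aemeasurable (κ := η') ?_).trans hηη'.symm
  rw [h, Measure.compProd_congr hηη']

/-- If the conditional distribution of `(Y, Z)` given `X` has a density `g` with respect to the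
product of the two conditional margins, then that of `Z` given `(X, Y)` has the section of `g` as
its density with respect to that of `Z` given `X`. The pair `(X, Y)` is encoded by the variable
`W = θ (X, Y)`, from which `φ` and `ψ` recover the components. -/
lemma condDistrib_adjoin_eq_withDensity {Ω E E' : Type*} [MeasurableSpace Ω] [MeasurableSpace E]
    [MeasurableSpace E'] {P : Measure Ω} [IsProbabilityMeasure P] {X : Ω → E} {Y Z : Ω → ℝ}
    {W : Ω → E'} (hX : Measurable X) (hY : Measurable Y) (hZ : Measurable Z) (hW : Measurable W)
    {φ : E' → E} {ψ : E' → ℝ} {θ : E × ℝ → E'} (hφ : Measurable φ) (hψ : Measurable ψ)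
    (hθ : Measurable θ) (hφθ : ∀ p, φ (θ p) = p.1) (hψθ : ∀ p, ψ (θ p) = p.2)
    (hθW : ∀ ω, θ (X ω, Y ω) = W ω) {g : E × ℝ × ℝ → ENNReal} (hg : Measurable g)
    (hg_top : ∀ p, g p ≠ ⊤)
    (hpair : ∀ᵐ v ∂P.map X, condDistrib (fun ω => (Y ω, Z ω)) X P v =
      ((condDistrib Y X P v).prod (condDistrib Z X P v)).withDensity fun p => g (v, p)) :
    ∀ᵐ w ∂P.map W, condDistrib Z W P w =
      (condDistrib Z X P (φ w)).withDensity fun z => g (φ w, ψ w, z) := by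
  have hg' : Measurable (Function.uncurry fun w z => g (φ w, ψ w, z)) := by
    unfold Function.uncurry
    fun_prop
  set η : Kernel E' ℝ := Kernel.withDensity ((condDistrib Z X P).comap φ hφ)
    (fun w z => g (φ w, ψ w, z)) with hη
  have : IsSFiniteKernel η := Kernel.IsSFiniteKernel.withDensity _ fun w z => hg_top _
  have hη_apply : ∀ w, η w =
      (condDistrib Z X P (φ w)).withDensity fun z => g (φ w, ψ w, z) := fun w => by
    rw [hη, Kernel.withDensity_apply _ hg', Kernel.comap_apply]
  suffices condDistrib Z W P =ᵐ[P.map W] η by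
    filter_upwards [this] with w hw
    rw [hw, hη_apply]
  refine condDistrib_ae_eq_of_measure_eq_compProd_of_isSFiniteKernel hW hZ η ?_
  ext s hs
  have hWs : Measurable fun w => η w (Prod.mk w ⁻¹' s) := Kernel.measurable_kernel_prodMk_left hs
  have hmapW : P.map W = (P.map X ⊗ₘ condDistrib Y X P).map θ := by
    rw [compProd_map_condDistrib hY.aemeasurable, Measure.map_map hθ (hX.prodMk hY)]
    congr 1; ext ω; exact (hθW ω).symm
  have hmapWZ : P.map (fun ω => (W ω, Z ω)) =
      (P.map X ⊗ₘ condDistrib (fun ω => (Y ω, Z ω)) X P).map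
        fun p => (θ (p.1, p.2.1), p.2.2) := by
    rw [compProd_map_condDistrib (hY.prodMk hZ).aemeasurable,
      Measure.map_map (by fun_prop) (by fun_prop)]
    congr 1; ext ω : 1; simp [hθW]
  have hm : Measurable fun p : E × ℝ × ℝ => (θ (p.1, p.2.1), p.2.2) := by fun_prop
  have hWθ : Measurable fun p => η (θ p) (Prod.mk (θ p) ⁻¹' s) := hWs.comp hθ
  rw [Measure.compProd_apply hs, hmapW, lintegral_map hWs hθ,
    Measure.lintegral_compProd hWθ, hmapWZ, Measure.map_apply hm hs,
    Measure.compProd_apply (hm hs)]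
  -- Both sides are now integrals over the law of `X` of iterated integrals in `y` and `z`.
  refine lintegral_congr_ae ?_
  filter_upwards [hpair] with v hv
  have hsv : MeasurableSet
      (Prod.mk v ⁻¹' ((fun p : E × ℝ × ℝ => (θ (p.1, p.2.1), p.2.2)) ⁻¹' s)) :=
    measurable_prodMk_left (hm hs)
  have hgv : Measurable fun p => g (v, p) := hg.comp measurable_prodMk_left
  rw [hv, withDensity_apply _ hsv, ← lintegral_indicator hsv,
    lintegral_prod _ (hgv.indicator hsv).aemeasurable]
  refine lintegral_congr fun y => ?_
  have hsy : MeasurableSet (Prod.mk (θ (v, y)) ⁻¹' s) := measurable_prodMk_left hs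
  rw [hη_apply, withDensity_apply _ hsy, ← lintegral_indicator hsy, hφθ, hψθ]
  rfl

/-! ### Adjoining one conditioning variable -/

section Vine

variable {Ω : Type*} [MeasurableSpace Ω] {d : ℕ}

/-- The law of `(U_D, U_a)` is absolutely continuous with respect to a product measure whose second
factor is Lebesgue measure on `[0,1]`, hence so are almost all conditional distributions of
`U_a`. -/
lemma ae_nullSingletonClass_condDistrib {P : Measure Ω} [IsProbabilityMeasure P]
    {U : Ω → Fin d → ℝ} {c : (Fin d → ℝ) → ℝ}
    (hU : Measurable U) (hlaw : P.map U = copulaMeasure c)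
    {a : Fin d} {D : Finset (Fin d)} (ha : a ∉ D) :
    ∀ᵐ v ∂P.map (fun ω => D.restrict (U ω)), NullSingletonClass
      (condDistrib (fun ω => U ω a) (fun ω => D.restrict (U ω)) P v) := by
  have hUa : Measurable fun ω => U ω a := (measurable_pi_apply a).comp hU
  have hUD : Measurable fun ω => D.restrict (U ω) := (Finset.measurable_restrict D).comp hU
  set lam : Measure ℝ := volume.restrict (Icc (0 : ℝ) 1) with hlam
  have : IsProbabilityMeasure lam := ⟨by simp [hlam]⟩
  set π : Measure (Fin d → ℝ) := Measure.pi fun _ => lam with hπ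
  have hac : P.map U ≪ π := by
    rw [hlaw, copulaMeasure, hπ, hlam, ← restrict_Icc_pi]
    exact withDensity_absolutelyContinuous _ _
  have hproj : Measurable fun u : Fin d → ℝ => (D.restrict u, u a) :=
    (Finset.measurable_restrict D).prodMk (measurable_pi_apply a)
  have hindep : IndepFun (fun u : Fin d → ℝ => D.restrict u) (fun u => u a) π := by
    have h1 : iIndepFun (fun (i : Fin d) (u : Fin d → ℝ) => u i) π :=
      iIndepFun_pi (X := fun _ x => x) fun _ => aemeasurable_id
    have h2 := h1.indepFun_finset D {a} (Finset.disjoint_singleton_right.2 ha)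
      fun i => measurable_pi_apply i
    exact h2.comp measurable_id
      (measurable_pi_apply (⟨a, Finset.mem_singleton_self a⟩ : ({a} : Finset (Fin d))))
  have hprod := (indepFun_iff_map_prod_eq_prod_map_map
    (Finset.measurable_restrict D).aemeasurable (measurable_pi_apply a).aemeasurable).1 hindep
  have hmarg : π.map (fun u => u a) = lam :=
    (measurePreserving_eval (fun _ : Fin d => lam) a).map_eq
  have hac' : P.map (fun ω => D.restrict (U ω)) ⊗ₘ
      condDistrib (fun ω => U ω a) (fun ω => D.restrict (U ω)) P ≪
      π.map (fun u => D.restrict u) ⊗ₘ Kernel.const _ lam := by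
    rw [compProd_map_condDistrib hUa.aemeasurable, Measure.compProd_const, ← hmarg, ← hprod]
    have := hac.map hproj
    rwa [Measure.map_map hproj hU] at this
  filter_upwards [hac'.kernel_of_compProd] with v hv
  rw [Kernel.const_apply] at hv
  exact ⟨fun x => hv (by simp [hlam])⟩

lemma measurable_condDF (P : Measure Ω) [IsFiniteMeasure P] (U : Ω → Fin d → ℝ) (a : Fin d)
    (D : Finset (Fin d)) : Measurable fun p : (D → ℝ) × ℝ => condDF P U a D p.1 p.2 := by
  set κ := condDistrib (fun ω => U ω a) (fun ω => D.restrict (U ω)) P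
  have hs : MeasurableSet {p : ((D → ℝ) × ℝ) × ℝ | p.2 ≤ p.1.2} :=
    measurableSet_le measurable_snd (measurable_snd.comp measurable_fst)
  have := Kernel.measurable_kernel_prodMk_left (κ := κ.comap Prod.fst measurable_fst) hs
  exact this.ennreal_toReal

lemma condDF_mem_Icc (P : Measure Ω) [IsFiniteMeasure P] (U : Ω → Fin d → ℝ) (a : Fin d)
    (D : Finset (Fin d)) (v : D → ℝ) (x : ℝ) : condDF P U a D v x ∈ Icc (0 : ℝ) 1 :=
  ⟨measureReal_nonneg, measureReal_le_one⟩

lemma measurable_pairCopula_condDF (P : Measure Ω) [IsFiniteMeasure P] (U : Ω → Fin d → ℝ)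
    (a b : Fin d) (D : Finset (Fin d)) {q : (D → ℝ) → (Fin 2 → ℝ) → ℝ}
    (hq : Measurable (Function.uncurry q)) :
    Measurable fun p : (D → ℝ) × ℝ × ℝ =>
      q p.1 ![condDF P U a D p.1 p.2.1, condDF P U b D p.1 p.2.2] := by
  have h : Measurable fun p : (D → ℝ) × ℝ × ℝ =>
      ![condDF P U a D p.1 p.2.1, condDF P U b D p.1 p.2.2] := by
    refine measurable_pi_iff.2 fun i => ?_
    fin_cases i
    · exact (measurable_condDF P U a D).comp
        (by fun_prop : Measurable fun p : (D → ℝ) × ℝ × ℝ => (p.1, p.2.1))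
    · exact (measurable_condDF P U b D).comp
        (by fun_prop : Measurable fun p : (D → ℝ) × ℝ × ℝ => (p.1, p.2.2))
  exact hq.comp (measurable_fst.prodMk h)

lemma condDistrib_insert_eq_withDensity {P : Measure Ω} [IsProbabilityMeasure P]
    {U : Ω → Fin d → ℝ} {c : (Fin d → ℝ) → ℝ}
    (hU : Measurable U) (hlaw : P.map U = copulaMeasure c)
    {a b : Fin d} {D D' : Finset (Fin d)} (hD' : D' = insert a D) (ha : a ∉ D) (hb : b ∉ D)
    {q : (D → ℝ) → (Fin 2 → ℝ) → ℝ} (hq : IsCondPairCopulaDensity P U a b D q) :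
    ∀ᵐ w ∂P.map (fun ω => D'.restrict (U ω)), ∀ u : Fin d → ℝ, D'.restrict u = w →
      condDistrib (fun ω => U ω b) (fun ω => D'.restrict (U ω)) P w =
        (condDistrib (fun ω => U ω b) (fun ω => D.restrict (U ω)) P (D.restrict u)).withDensity
          fun z => ENNReal.ofReal (q (D.restrict u)
            ![condDF P U a D (D.restrict u) (u a), condDF P U b D (D.restrict u) z]) := by
  subst hD'
  have hUa : Measurable fun ω => U ω a := (measurable_pi_apply a).comp hU
  have hUb : Measurable fun ω => U ω b := (measurable_pi_apply b).comp hU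
  have hUD : ∀ D : Finset (Fin d), Measurable fun ω => D.restrict (U ω) :=
    fun D => (Finset.measurable_restrict D).comp hU
  have hg : Measurable fun p : (D → ℝ) × ℝ × ℝ => ENNReal.ofReal
      (q p.1 ![condDF P U a D p.1 p.2.1, condDF P U b D p.1 p.2.2]) :=
    (measurable_pairCopula_condDF P U a b D hq.measurable).ennreal_ofReal
  have hpair : ∀ᵐ v ∂P.map (fun ω => D.restrict (U ω)),
      condDistrib (fun ω => (U ω a, U ω b)) (fun ω => D.restrict (U ω)) P v =
        ((condDistrib (fun ω => U ω a) (fun ω => D.restrict (U ω)) P v).prod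
          (condDistrib (fun ω => U ω b) (fun ω => D.restrict (U ω)) P v)).withDensity
          fun p => ENNReal.ofReal (q v ![condDF P U a D v p.1, condDF P U b D v p.2]) := by
    filter_upwards [hq.isCopulaDensity, hq.sklar, ae_nullSingletonClass_condDistrib hU hlaw ha,
      ae_nullSingletonClass_condDistrib hU hlaw hb] with v h1 h2 h3 h4
    exact eq_withDensity_of_sklar _ _ _ h1 h2
  have hmeasθ : Measurable fun (p : (D → ℝ) × ℝ) (i : (insert a D : Finset (Fin d))) =>
      if h : (i : Fin d) ∈ D then p.1 ⟨i, h⟩ else p.2 := by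
    refine measurable_pi_iff.2 fun i => ?_
    split_ifs with h
    · exact (measurable_pi_apply _).comp measurable_fst
    · exact measurable_snd
  have key := condDistrib_adjoin_eq_withDensity (W := fun ω => (insert a D).restrict (U ω))
    (hUD D) hUa hUb (hUD _)
    (φ := Finset.restrict₂ (π := fun _ : Fin d => ℝ) (Finset.subset_insert a D))
    (ψ := fun w => w ⟨a, Finset.mem_insert_self a D⟩) (Finset.measurable_restrict₂ _)
    (measurable_pi_apply _) hmeasθ (fun p => funext fun i => dif_pos i.2)
    (fun p => dif_neg ha) (fun ω => by
      ext i
      rcases Finset.mem_insert.1 i.2 with h | h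
      · simp [h, ha]
      · simp [h]) hg (fun _ => ENNReal.ofReal_ne_top) hpair
  filter_upwards [key] with w hw u hu
  rw [hw, ← hu]
  rfl

/-- The induction step of the decomposition: conditioning on one more variable `U_a` multiplies the
conditional density of `U_b` by the pair-copula term of `a` and `b` given `D`. -/
lemma IsCondDensity.insert {P : Measure Ω} [IsProbabilityMeasure P]
    {U : Ω → Fin d → ℝ} {c : (Fin d → ℝ) → ℝ}
    (hU : Measurable U) (hlaw : P.map U = copulaMeasure c)
    {a b : Fin d} {D D' : Finset (Fin d)} (hD' : D' = insert a D) (ha : a ∉ D) (hb : b ∉ D)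
    (hab : a ≠ b) {q : (D → ℝ) → (Fin 2 → ℝ) → ℝ} (hq : IsCondPairCopulaDensity P U a b D q)
    {f : (Fin d → ℝ) → ℝ} (hf : Measurable f) (h : IsCondDensity P U b D f) :
    IsCondDensity P U b D' fun u => q (D.restrict u)
      ![condDF P U a D (D.restrict u) (u a), condDF P U b D (D.restrict u) (u b)] * f u := by
  have hsub : D ⊆ D' := hD' ▸ Finset.subset_insert a D
  have hres : Measurable (Finset.restrict₂ (π := fun _ : Fin d => ℝ) hsub) :=
    Finset.measurable_restrict₂ hsub
  have hUD' : Measurable fun ω => D'.restrict (U ω) := (Finset.measurable_restrict D').comp hU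
  have hmap : P.map (fun ω => D.restrict (U ω)) =
      (P.map fun ω => D'.restrict (U ω)).map
        (Finset.restrict₂ (π := fun _ : Fin d => ℝ) hsub) := by
    rw [Measure.map_map hres hUD']
    rfl
  have h' := h
  have hcop := hq.isCopulaDensity
  rw [IsCondDensity, hmap] at h'
  rw [hmap] at hcop
  filter_upwards [ae_of_ae_map hres.aemeasurable h', ae_of_ae_map hres.aemeasurable hcop,
    condDistrib_insert_eq_withDensity hU hlaw hD' ha hb hq] with w hw hcw hins u hu
  have hru : Finset.restrict₂ (π := fun _ : Fin d => ℝ) hsub w = D.restrict u := by rw [← hu]; rfl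
  rw [hru] at hw hcw
  have hupd : ∀ x, D.restrict (Function.update u b x) = D.restrict u := fun x => by
    ext i
    exact Function.update_of_ne (ne_of_mem_of_not_mem i.2 hb) _ _
  have hg : Measurable fun z => ENNReal.ofReal (q (D.restrict u)
      ![condDF P U a D (D.restrict u) (u a), condDF P U b D (D.restrict u) z]) :=
    ((measurable_pairCopula_condDF P U a b D hq.measurable).ennreal_ofReal).comp
      (by fun_prop : Measurable fun z : ℝ => (D.restrict u, u a, z))
  have hfm : Measurable fun x => ENNReal.ofReal (f (Function.update u b x)) :=
    (hf.comp (measurable_update u)).ennreal_ofReal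
  rw [hins u hu, hw u rfl, ← withDensity_mul _ hfm hg]
  congr 1
  ext x
  rw [hupd, Function.update_of_ne hab, Function.update_self, Pi.mul_apply, mul_comm,
    ENNReal.ofReal_mul (hcw.nonneg _ ?_)]
  -- `ENNReal.ofReal` is multiplicative as soon as the first factor is nonnegative, and copula
  -- densities are so only on the unit square, where the distribution functions take their values.
  simp [Pi.le_def, Fin.forall_fin_two, (condDF_mem_Icc P U _ D _ _).1,
    (condDF_mem_Icc P U _ D _ _).2]

/-! ### Columns of a vine structure matrix with identity diagonal -/

lemma vineColumn_eq_Ici {M : Matrix (Fin d) (Fin d) (Fin d)} (hM : IsVineStructureMatrix M)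
    (hdiag : ∀ i, M i i = i) (j : Fin d) : vineColumn M j = Finset.Ici j := by
  refine (Finset.eq_of_subset_of_card_le (fun i hi => ?_) Finset.card_image_le).symm
  have hi' : i ∈ vineColumn M i :=
    Finset.mem_image.2 ⟨i, Finset.mem_Ici.2 le_rfl, hdiag i⟩
  rcases (Finset.mem_Ici.1 hi).eq_or_lt with rfl | hlt
  · exact hi'
  · exact hM.column_subset j i hlt hi'

lemma injOn_column {M : Matrix (Fin d) (Fin d) (Fin d)} (hM : IsVineStructureMatrix M)
    (hdiag : ∀ i, M i i = i) (j : Fin d) : InjOn (fun l => M l j) (Ici j) := by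
  rw [← Finset.coe_Ici]
  exact Finset.card_image_iff.1 (congrArg Finset.card (vineColumn_eq_Ici hM hdiag j))

lemma notMem_vineBelow {M : Matrix (Fin d) (Fin d) (Fin d)} (hM : IsVineStructureMatrix M)
    (hdiag : ∀ i, M i i = i) {j l k : Fin d} (hjl : j ≤ l) (hlk : l ≤ k) :
    M l j ∉ vineBelow M k j := by
  intro h
  obtain ⟨l', hl', he⟩ := Finset.mem_image.1 h
  have hl'k := Finset.mem_Ioi.1 hl'
  have := injOn_column hM hdiag j (hjl.trans (hlk.trans hl'k.le)) hjl he
  exact absurd (this ▸ hl'k) (not_lt.2 hlk)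

lemma vineBelow_self {M : Matrix (Fin d) (Fin d) (Fin d)} (hM : IsVineStructureMatrix M)
    (hdiag : ∀ i, M i i = i) (j : Fin d) : vineBelow M j j = Finset.Ioi j := by
  have h1 : insert j (vineBelow M j j) = insert j (Finset.Ioi j) := by
    have h := vineColumn_eq_Ici hM hdiag j
    rw [vineColumn, ← Finset.Ioi_insert, Finset.image_insert, hdiag] at h
    exact h
  have h2 : j ∉ vineBelow M j j := by
    simpa only [hdiag] using notMem_vineBelow hM hdiag (le_refl j) (le_refl j)
  rw [← Finset.erase_insert h2, h1, Finset.erase_insert (by simp)]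

/-! ### Descending along a column -/

lemma HasVineCopulaDensity.map_apply {P : Measure Ω} [IsFiniteMeasure P] {U : Ω → Fin d → ℝ}
    {M : Matrix (Fin d) (Fin d) (Fin d)} {pc : PairCopulaFamily d} {c : (Fin d → ℝ) → ℝ}
    (hU : HasVineCopulaDensity P U M pc c) (i : Fin d) :
    P.map (fun ω => U ω i) = volume.restrict (Icc (0 : ℝ) 1) := by
  rw [← hU.isCopulaDensity.uniform_margin i, ← hU.law,
    Measure.map_map (measurable_pi_apply i) hU.measurable]
  rfl

lemma HasVineCopulaDensity.isCondDensity_empty {P : Measure Ω} [IsProbabilityMeasure P]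
    {U : Ω → Fin d → ℝ} {M : Matrix (Fin d) (Fin d) (Fin d)} {pc : PairCopulaFamily d}
    {c : (Fin d → ℝ) → ℝ} (hU : HasVineCopulaDensity P U M pc c) (i : Fin d) :
    IsCondDensity P U i ∅ fun _ => 1 := by
  have hUi : Measurable fun ω => U ω i := (measurable_pi_apply i).comp hU.measurable
  have hUe : Measurable fun ω => (∅ : Finset (Fin d)).restrict (U ω) :=
    (Finset.measurable_restrict ∅).comp hU.measurable
  have hindep : IndepFun (fun ω => (∅ : Finset (Fin d)).restrict (U ω)) (fun ω => U ω i) P := by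
    have hconst : (fun ω => (∅ : Finset (Fin d)).restrict (U ω)) =
        fun _ => (∅ : Finset (Fin d)).restrict (0 : Fin d → ℝ) := by
      ext ω k
      exact absurd k.2 (Finset.notMem_empty _)
    rw [hconst]
    exact indepFun_const_left _ _
  have h : condDistrib (fun ω => U ω i) (fun ω => (∅ : Finset (Fin d)).restrict (U ω)) P
      =ᵐ[P.map fun ω => (∅ : Finset (Fin d)).restrict (U ω)]
        Kernel.const _ (P.map fun ω => U ω i) := by
    refine condDistrib_ae_eq_of_measure_eq_compProd _ hUi.aemeasurable ?_
    rw [Measure.compProd_const]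
    exact (indepFun_iff_map_prod_eq_prod_map_map hUe.aemeasurable hUi.aemeasurable).1 hindep
  filter_upwards [h] with v hv u _
  rw [hv, Kernel.const_apply, hU.map_apply]
  simp

lemma HasVineCopulaDensity.measurable_pairCopulaTerm {P : Measure Ω} [IsFiniteMeasure P]
    {U : Ω → Fin d → ℝ} {M : Matrix (Fin d) (Fin d) (Fin d)} {pc : PairCopulaFamily d}
    {c : (Fin d → ℝ) → ℝ} (hU : HasVineCopulaDensity P U M pc c) {k j : Fin d} (hjk : j < k) :
    Measurable (pairCopulaTerm P U M pc k j) := by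
  have h : Measurable fun u : Fin d → ℝ =>
      ((vineBelow M k j).restrict u, u (M k j), u (M j j)) :=
    (Finset.measurable_restrict _).prodMk
      ((measurable_pi_apply (M k j)).prodMk (measurable_pi_apply (M j j)))
  exact (measurable_pairCopula_condDF P U (M k j) (M j j) _
    (hU.pairCopula j k hjk).measurable).comp h

/-- Induction on the number `n` of rows below row `k`, that is, upwards along column `j`. -/
lemma HasVineCopulaDensity.isCondDensity_vineBelow {P : Measure Ω} [IsProbabilityMeasure P]
    {U : Ω → Fin d → ℝ} {M : Matrix (Fin d) (Fin d) (Fin d)} {pc : PairCopulaFamily d}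
    {c : (Fin d → ℝ) → ℝ} (hU : HasVineCopulaDensity P U M pc c) (hdiag : ∀ i, M i i = i)
    (j : Fin d) (n : ℕ) : ∀ k : Fin d, j ≤ k → (k : ℕ) + n + 1 = d →
      IsCondDensity P U j (vineBelow M k j)
        fun u => ∏ l ∈ Finset.Ioi k, pairCopulaTerm P U M pc l j u := by
  have hM := hU.isVineStructureMatrix
  induction n with
  | zero =>
    intro k _ hk
    have h1 : Finset.Ioi k = ∅ := by
      ext l
      simp only [Finset.mem_Ioi, Finset.notMem_empty, iff_false, not_lt, Fin.le_def]
      omega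
    rw [vineBelow, h1]
    simpa using hU.isCondDensity_empty j
  | succ n ih =>
    intro k hjk hk
    obtain ⟨k', hk'⟩ : ∃ k' : Fin d, (k' : ℕ) = k + 1 := ⟨⟨k + 1, by omega⟩, rfl⟩
    have hkk' : k < k' := Fin.lt_def.2 (by omega)
    have hjk' : j < k' := hjk.trans_lt hkk'
    have hIoi : Finset.Ioi k = insert k' (Finset.Ioi k') := by
      ext l
      simp only [Finset.mem_Ioi, Finset.mem_insert, Fin.lt_def, Fin.ext_iff]
      omega
    have hbelow : vineBelow M k j = insert (M k' j) (vineBelow M k' j) := by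
      rw [vineBelow, hIoi, Finset.image_insert, vineBelow]
    have hj : M j j ∉ vineBelow M k' j := notMem_vineBelow hM hdiag le_rfl hjk'.le
    have hne : M k' j ≠ M j j := fun h =>
      hjk'.ne' (injOn_column hM hdiag j hjk'.le (le_refl j) h)
    have hih := ih k' hjk'.le (by omega)
    have hstep := IsCondDensity.insert hU.measurable hU.law hbelow
      (notMem_vineBelow hM hdiag hjk'.le le_rfl) hj hne (hU.pairCopula j k' hjk')
      (Finset.measurable_prod _ fun l hl =>
        hU.measurable_pairCopulaTerm (hjk'.trans (Finset.mem_Ioi.1 hl)))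
      ((hdiag j).symm ▸ hih)
    simp only [hIoi, Finset.prod_insert (Finset.notMem_Ioi_self (b := k'))]
    have hgoal : IsCondDensity P U (M j j) (vineBelow M k j) fun u =>
        pairCopulaTerm P U M pc k' j u *
          ∏ l ∈ Finset.Ioi k', pairCopulaTerm P U M pc l j u := hstep
    rwa [hdiag] at hgoal

end Vine

theorem proposition1 {Ω : Type*} [MeasurableSpace Ω] (P : Measure Ω) [IsProbabilityMeasure P]
    {d : ℕ} (U : Ω → Fin d → ℝ) (M : Matrix (Fin d) (Fin d) (Fin d))
    (pc : PairCopulaFamily d) (c : (Fin d → ℝ) → ℝ)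
    (hU : HasVineCopulaDensity P U M pc c) (hdiag : ∀ i : Fin d, M i i = i)
    (j : Fin d) (hj : (j : ℕ) + 1 < d) :
    IsCondDensity P U j (Finset.Ioi j)
      (fun u => ∏ k ∈ Finset.Ioi j, pairCopulaTerm P U M pc k j u) := by
  have h := hU.isCondDensity_vineBelow hdiag j (d - 1 - j) j le_rfl (by omega)
  rwa [vineBelow_self hU.isVineStructureMatrix hdiag] at h
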